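/- Let $X$ be a standard Borel space and let $\mathcal R\subset X\times X$ be a discrete Borel equivalence relation, i.e. $\mathcal R$ is Borel and every class $[x]_{\mathcal R}$ is countable. Let $\pi:\mathcal H\to X$ be a bundle of hyperbolic spaces: $\mathcal H$ is a standard Borel space, $\pi$ is a Borel surjection, each fiber $\mathcal H_x=\pi^{-1}(x)$ carries a metric for which it is a geodesic Gromov hyperbolic space, and the resulting map $d$ on $\{(p,q)\in\mathcal H\times\mathcal H:\pi(p)=\pi(q)\}$ is Borel. Let $\mathcal R$ act on $\mathcal H$ by isometries: there are isometries $\alpha(x,y):\mathcal H_y\to\mathcal H_x$ for $(x,y)\in\mathcal R$ such that $\alpha(x,y)\alpha(y,z)=\alpha(x,z)$ and $\{(p,q)\in\mathcal H\times\mathcal H:(\pi(p),\pi(q))\in\mathcal R,\ \alpha(\pi(p),\pi(q))q=p\}$ is Borel. Let $\sigma:X\to\mathcal H$ be a Borel section, let $\sigma_x:[x]_{\mathcal R}\to\mathcal H_x$ be the map $\sigma_x(y)=\alpha(x,y)\sigma(y)$, and let $d_\sigma(x,y)=d(\sigma_z(x),\sigma_z(y))$ for $(x,y)\in\mathcal R$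 and any $z\in[x]_{\mathcal R}$ (this does not depend on $z$). Suppose that for every $x\in X$ every metric ball of $\mathcal H_x$ contains only finitely many points of the orbit $\sigma_x([x]_{\mathcal R})$ ($\sigma$ is metrically proper), and that for some real $r>0$ and every $x\in X$ the open $r$-neighborhood of the orbit $\sigma_x([x]_{\mathcal R})$ is all of $\mathcal H_x$ ($\sigma$ is $r$-cobounded). Then $$\mathcal G=\{(x,y)\in\mathcal R:\ d_\sigma(x,y)\le 3r\}$$ is a hyperbolic graphing of $\mathcal R$: $\mathcal G$ is Borel and symmetric, $\mathcal R$ is the smallest equivalence relation containing $\mathcal G$, and for every $x\in X$ the metric graph (edges of length $1$) with vertex set $[x]_{\mathcal R}$ and edges $\{y,z\}$, $y\neq z$, $(y,z)\in\mathcal G$, is Gromov hyperbolic. If moreover every map $\sigma_x$ is finite-to-one, so that $\sigma_x^{-1}(B)$ is finite for every metric ball $B\subset\mathcal H_x$, then $\mathcal G$ is locally finite: for every $x\in X$ there are only finitely many $y$ with $(x,y)\in\mathcal G$. -/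

import Mathlib

noncomputable section

namespace HypBundle

/-! ### Gromov hyperbolicity -/

/-- The Gromov product `(x|y)_z` with respect to a distance function `d`. -/
def gromovProduct {Y : Type*} (d : Y → Y → ℝ) (x y z : Y) : ℝ :=
  (d x z + d y z - d x y) / 2

/-- `d` is `δ`-hyperbolic for some real `δ`. -/
def GromovHyperbolic {Y : Type*} (d : Y → Y → ℝ) : Prop :=
  ∃ δ : ℝ, ∀ x y z w : Y,
    min (gromovProduct d x w z) (gromovProduct d w y z) - δ ≤ gromovProduct d x y z

/-- Any two points are joined by a geodesic. -/
def IsGeodesicSpace (Y : Type*) [MetricSpace Y] : Prop :=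
  ∀ a b : Y, ∃ γ : ℝ → Y, γ 0 = a ∧ γ (dist a b) = b ∧
    ∀ s ∈ Set.Icc 0 (dist a b), ∀ t ∈ Set.Icc 0 (dist a b), dist (γ s) (γ t) = |s - t|

/-! ### The metric graph of a connected simple graph -/

/-- A point of the metric graph in which every edge of `G` is an interval of length `1`: either
the point at distance `pos` from `src` on the edge from `src` to `tgt`, or a vertex
(`src = tgt`, `pos = 0`). A point may be presented in several ways; two presentations of the same
point are at distance `0` for `MetricGraphPoint.dist`. -/
structure MetricGraphPoint {V : Type*} (G : SimpleGraph V) where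
  src : V
  tgt : V
  pos : ℝ
  pos_mem : pos ∈ Set.Icc (0 : ℝ) 1
  edge : G.Adj src tgt ∨ (src = tgt ∧ pos = 0)

open Classical in
/-- The length of a shortest path in the metric graph (meaningful for connected `G`). Two points
of one edge are joined along that edge; otherwise a shortest path leaves each of the two edges
through one of its end points. -/
def MetricGraphPoint.dist {V : Type*} {G : SimpleGraph V} (p q : MetricGraphPoint G) : ℝ :=
  if p.src = q.src ∧ p.tgt = q.tgt then |p.pos - q.pos|
  else if p.src = q.tgt ∧ p.tgt = q.src then |p.pos - (1 - q.pos)|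
  else
    min
      (min (p.pos + G.dist p.src q.src + q.pos)
        (p.pos + G.dist p.src q.tgt + (1 - q.pos)))
      (min ((1 - p.pos) + G.dist p.tgt q.src + q.pos)
        ((1 - p.pos) + G.dist p.tgt q.tgt + (1 - q.pos)))

/-- The vertex `v` as a point of the metric graph. -/
def MetricGraphPoint.vertex {V : Type*} (G : SimpleGraph V) (v : V) : MetricGraphPoint G :=
  ⟨v, v, 0, by simp, Or.inr ⟨rfl, rfl⟩⟩

/-- Between vertices the distance in the metric graph is the combinatorial one. -/
theorem MetricGraphPoint.dist_vertex {V : Type*} (G : SimpleGraph V) (v w : V) :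
    (MetricGraphPoint.vertex G v).dist (MetricGraphPoint.vertex G w) = G.dist v w := by
  by_cases h : v = w
  · subst h; simp [MetricGraphPoint.dist, MetricGraphPoint.vertex]
  · simp only [MetricGraphPoint.dist, MetricGraphPoint.vertex, h, and_self, if_false]
    rw [min_eq_left, min_eq_left] <;> simp

/-! ### Equivalence relations and graphings -/

section Relations

variable {X : Type*}

/-- The equivalence class `[x]_R`. -/
abbrev EqClass (R : Setoid X) (x : X) : Type _ := {y : X // R x y}

/-- `R` is a discrete Borel equivalence relation: it is a Borel subset of `X × X` and its classes
are countable. -/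
structure IsDiscreteBorel [MeasurableSpace X] (R : Setoid X) : Prop where
  measurableSet : MeasurableSet {p : X × X | R p.1 p.2}
  countable_class : ∀ x : X, {y : X | R x y}.Countable

/-- `𝒢` is a graphing of `R`: a symmetric Borel subset of `R` such that `R` is the smallest
equivalence relation containing it. -/
structure IsGraphing [MeasurableSpace X] (R : Setoid X) (𝒢 : Set (X × X)) : Prop where
  measurableSet : MeasurableSet 𝒢
  symm : ∀ x y : X, (x, y) ∈ 𝒢 → (y, x) ∈ 𝒢
  generates : IsLeast {S : Setoid X | ∀ x y : X, (x, y) ∈ 𝒢 → S x y} R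

/-- The graph `𝒢_x`: its vertex set is `[x]_R` and its edges are the pairs `{y, z}`, `y ≠ z`,
with `(y, z) ∈ 𝒢`. -/
def graphAt (R : Setoid X) (𝒢 : Set (X × X)) (x : X) : SimpleGraph (EqClass R x) :=
  SimpleGraph.fromRel fun y z => (y.1, z.1) ∈ 𝒢

/-- A graphing is hyperbolic if each metric graph `𝒢_x` is Gromov hyperbolic. -/
structure IsHyperbolicGraphing [MeasurableSpace X] (R : Setoid X) (𝒢 : Set (X × X)) : Prop where
  isGraphing : IsGraphing R 𝒢
  hyperbolic : ∀ x : X, GromovHyperbolic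
    (MetricGraphPoint.dist : MetricGraphPoint (graphAt R 𝒢 x) → _ → ℝ)

/-- Every vertex has finitely many neighbours. -/
def IsLocallyFinite (𝒢 : Set (X × X)) : Prop :=
  ∀ x : X, {y : X | (x, y) ∈ 𝒢}.Finite

end Relations

/-! ### Metric bundles, actions and sections -/

/-- A metric bundle over `X` with total space `H` (standard Borel in the theorem): a Borel
surjection `H → X` with a metric on every fiber that is Borel as a function on the fiber
product. -/
structure MetricBundle (X H : Type*) [MeasurableSpace X] [MeasurableSpace H] where
  proj : H → X
  measurable_proj : Measurable proj
  surjective_proj : Function.Surjective proj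
  metric : ∀ x : X, MetricSpace {p : H // proj p = x}
  measurable_dist : Measurable fun p : {p : H × H // proj p.1 = proj p.2} =>
    (metric (proj p.1.1)).dist ⟨p.1.1, rfl⟩ ⟨p.1.2, p.2.symm⟩

variable {X H : Type*} [MeasurableSpace X] [MeasurableSpace H]

/-- The fiber over `x`. -/
def MetricBundle.Fiber (B : MetricBundle X H) (x : X) : Type _ := {p : H // B.proj p = x}

instance (B : MetricBundle X H) (x : X) : MetricSpace (B.Fiber x) := B.metric x

/-- Each fiber is a geodesic Gromov hyperbolic space. -/
def MetricBundle.IsHyperbolic (B : MetricBundle X H) : Prop :=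
  ∀ x : X, IsGeodesicSpace (B.Fiber x) ∧
    GromovHyperbolic (dist : B.Fiber x → B.Fiber x → ℝ)

/-- A Borel section of the bundle. -/
structure BorelSection (B : MetricBundle X H) where
  toFun : X → H
  measurable_toFun : Measurable toFun
  proj_toFun : ∀ x : X, B.proj (toFun x) = x

/-- The value `σ(x)` as a point of the fiber over `x`. -/
def BorelSection.val {B : MetricBundle X H} (σ : BorelSection B) (x : X) : B.Fiber x :=
  ⟨σ.toFun x, σ.proj_toFun x⟩

/-- An action of `R` on the bundle by isometries `α(x,y) : H_y → H_x`, `(x,y) ∈ R`. -/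
structure IsometricAction (R : Setoid X) (B : MetricBundle X H) where
  map : ∀ {x y : X}, R x y → (B.Fiber y ≃ᵢ B.Fiber x)
  cocycle : ∀ {x y z : X} (hxy : R x y) (hyz : R y z) (p : B.Fiber z),
    map hxy (map hyz p) = map (R.trans hxy hyz) p
  borel : MeasurableSet {pq : H × H | ∃ h : R (B.proj pq.1) (B.proj pq.2),
    map h ⟨pq.2, rfl⟩ = (⟨pq.1, rfl⟩ : B.Fiber (B.proj pq.1))}

namespace IsometricAction

variable {R : Setoid X} {B : MetricBundle X H} (α : IsometricAction R B) (σ : BorelSection B)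

/-- The map `σ_x : [x]_R → H_x`, `σ_x(y) = α(x,y) σ(y)`; its range is the orbit of `x`. -/
def orbitMap (x : X) (y : EqClass R x) : B.Fiber x := α.map y.2 (σ.val y.1)

/-- Every metric ball of `H_x` contains only finitely many points of the orbit of `x`. -/
def MetricallyProper : Prop :=
  ∀ (x : X) (c : B.Fiber x) (s : ℝ), (Set.range (α.orbitMap σ x) ∩ Metric.ball c s).Finite

/-- Every point of an orbit is attained by only finitely many members of the class. -/
def FiniteToOne : Prop :=
  ∀ (x : X) (p : B.Fiber x), {y : EqClass R x | α.orbitMap σ x y = p}.Finite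

/-- The open `r`-neighbourhood of the orbit of `x` is all of `H_x`. -/
def Cobounded (r : ℝ) : Prop :=
  ∀ (x : X) (p : B.Fiber x), ∃ y : EqClass R x, dist p (α.orbitMap σ x y) < r

/-- `d_σ(x,y) = d(σ_z(x), σ_z(y))`, computed with `z = x`. -/
def dSigma {x y : X} (h : R x y) : ℝ :=
  dist (α.orbitMap σ x ⟨x, R.refl x⟩) (α.orbitMap σ x ⟨y, h⟩)

/-- The value of `d_σ` does not depend on the choice of `z`. -/
theorem dSigma_eq {x y z : X} (h : R x y) (hx : R z x) (hy : R z y) :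
    α.dSigma σ h = dist (α.orbitMap σ z ⟨x, hx⟩) (α.orbitMap σ z ⟨y, hy⟩) := by
  unfold dSigma orbitMap
  rw [← (α.map hx).dist_eq, α.cocycle, α.cocycle]

/-- The relation `{(x,y) ∈ R : d_σ(x,y) ≤ s}`. -/
def proximityGraph (s : ℝ) : Set (X × X) :=
  {p | ∃ h : R p.1 p.2, α.dSigma σ h ≤ s}

end IsometricAction

end HypBundle

end

/-!
A geodesic of a hyperbolic space stays in a bounded neighbourhood of every discrete quasi-geodesic
with the same end points: at the point of the geodesic farthest from the quasi-geodesic, at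
distance `D`, a short detour through the quasi-geodesic has length linear in `D`, whereas binary
subdivision shows that it must be exponentially long in `D`.

Hence, if a connected graph embeds quasi-isometrically into a geodesic hyperbolic space, points of
geodesics in the space are shadowed by vertices of graph geodesics. This bounds Gromov products of
the graph by those of the space and supplies every triple of vertices with an approximate centre,
which together force the graph to be hyperbolic. Coboundedness makes the orbit maps `σ_x` such
embeddings of the proximity graph. The proximity relation is Borel by the Lusin–Souslin theorem,
being a one-to-one projection of the graph of `(x, y) ↦ α(x,y) σ(y)` over it.
-/

namespace HypBundle

open Set Filter Asymptotics

/-! ### Gromov products and hyperbolicity -/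

section GromovProduct

variable {Y Z : Type*}

/-- `d` is `δ`-hyperbolic: `GromovHyperbolic` with its constant made explicit, so that estimates
can be stated in terms of `δ`. -/
def GromovHyperbolicWith (d : Y → Y → ℝ) (δ : ℝ) : Prop :=
  ∀ x y z w : Y,
    min (gromovProduct d x w z) (gromovProduct d w y z) - δ ≤ gromovProduct d x y z

theorem GromovHyperbolicWith.nonneg [Nonempty Y] {d : Y → Y → ℝ} {δ : ℝ}
    (h : GromovHyperbolicWith d δ) : 0 ≤ δ := by
  obtain ⟨x⟩ := ‹Nonempty Y›
  have := h x x x x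
  rw [min_self] at this
  linarith

theorem GromovHyperbolicWith.min_min_sub_le [Nonempty Y] {d : Y → Y → ℝ} {δ : ℝ}
    (h : GromovHyperbolicWith d δ) (x y z v w : Y) :
    min (gromovProduct d x v z) (min (gromovProduct d v w z) (gromovProduct d w y z)) - 2 * δ ≤
      gromovProduct d x y z := by
  have hδ := h.nonneg
  have hvy := h v y z w
  have hxy := h x y z v
  rcases min_choice (gromovProduct d x v z) (gromovProduct d v y z) with hmin | hmin
  · linarith [min_le_left (gromovProduct d x v z)
      (min (gromovProduct d v w z) (gromovProduct d w y z))]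
  · linarith [min_le_right (gromovProduct d x v z)
      (min (gromovProduct d v w z) (gromovProduct d w y z))]

theorem GromovHyperbolic.of_abs_sub_le {d : Y → Y → ℝ} {d' : Z → Z → ℝ} (h : GromovHyperbolic d)
    (g : Z → Y) {K : ℝ} (hK : ∀ p q, |d' p q - d (g p) (g q)| ≤ K) : GromovHyperbolic d' := by
  obtain ⟨δ, hδ⟩ := h
  have hprod (p q o : Z) :
      |gromovProduct d' p q o - gromovProduct d (g p) (g q) (g o)| ≤ 3 / 2 * K := by
    have hpo := abs_le.1 (hK p o)
    have hqo := abs_le.1 (hK q o)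
    have hpq := abs_le.1 (hK p q)
    unfold gromovProduct
    exact abs_le.2 ⟨by linarith, by linarith⟩
  refine ⟨δ + 3 * K, fun x y z w => ?_⟩
  have hmin : min (gromovProduct d' x w z) (gromovProduct d' w y z) - 3 / 2 * K ≤
      min (gromovProduct d (g x) (g w) (g z)) (gromovProduct d (g w) (g y) (g z)) :=
    le_min
      (by linarith [(abs_le.1 (hprod x w z)).2,
        min_le_left (gromovProduct d' x w z) (gromovProduct d' w y z)])
      (by linarith [(abs_le.1 (hprod w y z)).2,
        min_le_right (gromovProduct d' x w z) (gromovProduct d' w y z)])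
  linarith [hδ (g x) (g y) (g z) (g w), (abs_le.1 (hprod x y z)).1]

theorem gromovProduct_le_add {d : Y → Y → ℝ} (htri : ∀ x y z, d x z ≤ d x y + d y z)
    (x y z w : Y) : gromovProduct d x y z ≤ gromovProduct d x y w + d w z := by
  unfold gromovProduct
  linarith [htri x w z, htri y w z]

/-- The centre `v` of `x, y, z` gives `(x|y)_z ≥ d(v,z) - O(1)`; for every `w`, one of `(x|w)_v`
and `(w|y)_v` is bounded, hence one of `(x|w)_z` and `(w|y)_z` is at most `d(v,z) + O(1)`. -/
theorem gromovHyperbolic_of_gromovProduct_le_of_centers {d d' : Y → Y → ℝ}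
    (hcomm : ∀ x y, d x y = d y x) (htri : ∀ x y z, d x z ≤ d x y + d y z)
    (hd' : GromovHyperbolic d')
    (hprod : ∀ c, ∃ C, ∀ x y v, gromovProduct d' x y v ≤ c → gromovProduct d x y v ≤ C)
    (hcenter : ∃ c, ∀ x y z, ∃ v, gromovProduct d' x y v ≤ c ∧ gromovProduct d' x z v ≤ c ∧
      gromovProduct d' y z v ≤ c) :
    GromovHyperbolic d := by
  obtain ⟨δ, hδ⟩ := hd'
  obtain ⟨c, hc⟩ := hcenter
  obtain ⟨C, hC⟩ := hprod (c + δ)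
  refine ⟨3 * C, fun x y z w => ?_⟩
  have : Nonempty Y := ⟨x⟩
  have hδ0 : 0 ≤ δ := GromovHyperbolicWith.nonneg hδ
  obtain ⟨v, hxy, hxz, hyz⟩ := hc x y z
  have hlower : d v z - 2 * C ≤ gromovProduct d x y z := by
    have hxz' := hC x z v (by linarith)
    have hyz' := hC y z v (by linarith)
    unfold gromovProduct at hxz' hyz' ⊢
    linarith [htri x v y, hcomm v y, hcomm z v]
  have hupper (p q : Y) (h : gromovProduct d' p q v ≤ c + δ) :
      gromovProduct d p q z ≤ C + d v z :=
    (gromovProduct_le_add htri p q z v).trans (by linarith [hC p q v h])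
  have hmin : min (gromovProduct d' x w v) (gromovProduct d' w y v) ≤ c + δ := by
    linarith [hδ x y v w]
  rcases min_le_iff.1 hmin with h | h
  · linarith [hupper x w h, min_le_left (gromovProduct d x w z) (gromovProduct d w y z)]
  · linarith [hupper w y h, min_le_right (gromovProduct d x w z) (gromovProduct d w y z)]

end GromovProduct

section PseudoMetric

variable {Y : Type*} [PseudoMetricSpace Y]

theorem gromovProduct_comm (x y z : Y) :
    gromovProduct dist x y z = gromovProduct dist y x z := by
  unfold gromovProduct
  rw [dist_comm x y, add_comm (dist x z)]

theorem dist_sub_dist_le_gromovProduct (x y z : Y) :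
    dist x z - dist x y ≤ gromovProduct dist x y z := by
  unfold gromovProduct
  linarith [dist_triangle x y z]

theorem gromovProduct_mem_Icc (x y z : Y) : gromovProduct dist y z x ∈ Icc 0 (dist x y) := by
  unfold gromovProduct
  constructor
  · linarith [dist_triangle_right y z x]
  · linarith [dist_triangle z y x, dist_comm y x, dist_comm z y]

theorem GromovHyperbolicWith.sub_mul_le_gromovProduct_of_chain {δ : ℝ}
    (hδ : GromovHyperbolicWith (dist : Y → Y → ℝ) δ) {p : Y} {u : ℕ → Y} {m : ℝ} {n : ℕ}
    (hfar : ∀ l ≤ n, m ≤ dist (u l) p)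
    (hstep : ∀ l < n, m ≤ gromovProduct dist (u l) (u (l + 1)) p) (k : ℕ) {i j : ℕ}
    (hij : i ≤ j) (hj : j ≤ n) (hk : j ≤ i + 2 ^ k) :
    m - k * δ ≤ gromovProduct dist (u i) (u j) p := by
  induction k generalizing i j with
  | zero =>
    obtain rfl | rfl : j = i ∨ j = i + 1 := by rw [pow_zero] at hk; omega
    · simpa [gromovProduct] using hfar j hj
    · simpa using hstep i (by omega)
  | succ k ih =>
    let mid := min j (i + 2 ^ k)
    have hleft : m - k * δ ≤ gromovProduct dist (u i) (u mid) p :=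
      ih (by omega) (by omega) (by omega)
    have hright : m - k * δ ≤ gromovProduct dist (u mid) (u j) p :=
      ih (by omega) (by omega) (by omega)
    push_cast
    linarith [hδ (u i) (u j) p (u mid), le_min hleft hright]

/-! ### Geodesics -/

/-- `γ`, restricted to `[0, dist x y]`, is a geodesic from `x` to `y` parametrized by arc length;
its values outside this interval are irrelevant. -/
structure IsGeodesic (γ : ℝ → Y) (x y : Y) : Prop where
  map_zero : γ 0 = x
  map_dist : γ (dist x y) = y
  dist_eq : ∀ s ∈ Icc 0 (dist x y), ∀ t ∈ Icc 0 (dist x y), dist (γ s) (γ t) = |s - t|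

namespace IsGeodesic

variable {γ : ℝ → Y} {x y : Y} {s t u : ℝ}

theorem dist_eq_sub (hγ : IsGeodesic γ x y) (hs : 0 ≤ s) (hst : s ≤ t) (ht : t ≤ dist x y) :
    dist (γ s) (γ t) = t - s := by
  rw [hγ.dist_eq s ⟨hs, hst.trans ht⟩ t ⟨hs.trans hst, ht⟩, abs_sub_comm,
    abs_of_nonneg (sub_nonneg.2 hst)]

theorem dist_left (hγ : IsGeodesic γ x y) (ht : t ∈ Icc 0 (dist x y)) : dist x (γ t) = t := by
  simpa [hγ.map_zero] using hγ.dist_eq_sub le_rfl ht.1 ht.2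

theorem dist_right (hγ : IsGeodesic γ x y) (ht : t ∈ Icc 0 (dist x y)) :
    dist (γ t) y = dist x y - t := by
  simpa [hγ.map_dist] using hγ.dist_eq_sub ht.1 ht.2 le_rfl

theorem gromovProduct_eq_zero (hγ : IsGeodesic γ x y) (hs : 0 ≤ s) (hst : s ≤ t) (htu : t ≤ u)
    (hu : u ≤ dist x y) : gromovProduct dist (γ s) (γ u) (γ t) = 0 := by
  rw [gromovProduct, dist_comm (γ u), hγ.dist_eq_sub hs hst (htu.trans hu),
    hγ.dist_eq_sub (hs.trans hst) htu hu, hγ.dist_eq_sub hs (hst.trans htu) hu]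
  ring

theorem symm (hγ : IsGeodesic γ x y) : IsGeodesic (fun t => γ (dist x y - t)) y x where
  map_zero := by rw [sub_zero, hγ.map_dist]
  map_dist := by rw [dist_comm y x, sub_self, hγ.map_zero]
  dist_eq s hs t ht := by
    rw [dist_comm y x] at hs ht
    rw [hγ.dist_eq _ ⟨by linarith [hs.2], by linarith [hs.1]⟩ _
      ⟨by linarith [ht.2], by linarith [ht.1]⟩, sub_sub_sub_cancel_left, abs_sub_comm]

theorem continuousOn (hγ : IsGeodesic γ x y) : ContinuousOn γ (Icc 0 (dist x y)) :=
  (LipschitzOnWith.of_dist_le_mul (K := 1) fun s hs t ht => by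
    rw [hγ.dist_eq s hs t ht, NNReal.coe_one, one_mul, Real.dist_eq]).continuousOn

theorem dist_apply_gromovProduct_le {δ : ℝ} (hγ : IsGeodesic γ x y)
    (hδ : GromovHyperbolicWith (dist : Y → Y → ℝ) δ) (z : Y) :
    dist (γ (gromovProduct dist y z x)) z ≤ gromovProduct dist x y z + 2 * δ := by
  have ht := gromovProduct_mem_Icc x y z
  have hx := hγ.dist_left ht
  have hy := hγ.dist_right ht
  have hyp := hδ x y z (γ (gromovProduct dist y z x))
  set p := γ (gromovProduct dist y z x)
  have hxp : gromovProduct dist x p z = (gromovProduct dist x y z + dist p z) / 2 := by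
    unfold gromovProduct at hx ⊢
    linarith [dist_comm x y, dist_comm x z]
  have hpy : gromovProduct dist p y z = (gromovProduct dist x y z + dist p z) / 2 := by
    unfold gromovProduct at hy ⊢
    linarith [dist_comm x y, dist_comm x z]
  rw [hxp, hpy, min_self] at hyp
  linarith

theorem gromovProduct_apply_gromovProduct_le {δ : ℝ} (hγ : IsGeodesic γ x y)
    (hδ : GromovHyperbolicWith (dist : Y → Y → ℝ) δ) (z : Y) :
    gromovProduct dist x z (γ (gromovProduct dist y z x)) ≤ δ ∧
      gromovProduct dist y z (γ (gromovProduct dist y z x)) ≤ δ := by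
  have ht := gromovProduct_mem_Icc x y z
  have hx := hγ.dist_left ht
  have hy := hγ.dist_right ht
  have hz := hγ.dist_apply_gromovProduct_le hδ z
  set p := γ (gromovProduct dist y z x)
  unfold gromovProduct at hx hy hz ⊢
  constructor <;>
    linarith [dist_comm x y, dist_comm x z, dist_comm p z, dist_comm p y]

/-- Walk `2 * D` back from `γ t`, or back to the end point `x` if that comes first. -/
theorem exists_le_gromovProduct {S : Set Y} {D : ℝ} (hγ : IsGeodesic γ x y) (hx : x ∈ S)
    (hnear : ∀ s ∈ Icc 0 (dist x y), ∃ q ∈ S, dist (γ s) q ≤ D)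
    (ht : t ∈ Icc 0 (dist x y)) (hfar : ∀ q ∈ S, D ≤ dist q (γ t)) :
    ∃ s ∈ Icc 0 t, t - s ≤ 2 * D ∧ ∃ q ∈ S, dist (γ s) q ≤ D ∧
      D ≤ gromovProduct dist (γ s) q (γ t) := by
  have hD : 0 ≤ D := by
    obtain ⟨q, -, hq⟩ := hnear t ht
    exact dist_nonneg.trans hq
  rcases le_total t (2 * D) with hle | hle
  · refine ⟨0, ⟨le_rfl, ht.1⟩, by linarith, x, hx, ?_, ?_⟩
    · rwa [hγ.map_zero, dist_self]
    · simpa [hγ.map_zero, gromovProduct] using hfar x hx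
  · obtain ⟨q, hq, hqD⟩ := hnear (t - 2 * D) ⟨by linarith, by linarith [ht.2]⟩
    refine ⟨t - 2 * D, ⟨by linarith, by linarith⟩, by linarith, q, hq, hqD, ?_⟩
    have hdist := hγ.dist_eq_sub (s := t - 2 * D) (by linarith) (by linarith) ht.2
    linarith [dist_sub_dist_le_gromovProduct (γ (t - 2 * D)) q (γ t)]

theorem exists_dist_le_min_gromovProduct_le {S : Set Y} {D δ : ℝ} (hγ : IsGeodesic γ x y)
    (hδ : GromovHyperbolicWith (dist : Y → Y → ℝ) δ) (hx : x ∈ S) (hy : y ∈ S)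
    (hnear : ∀ s ∈ Icc 0 (dist x y), ∃ q ∈ S, dist (γ s) q ≤ D)
    (ht : t ∈ Icc 0 (dist x y)) (hfar : ∀ q ∈ S, D ≤ dist q (γ t)) :
    ∃ p ∈ S, ∃ q ∈ S, dist p q ≤ 6 * D ∧ min D (gromovProduct dist p q (γ t)) ≤ 2 * δ := by
  have : Nonempty Y := ⟨x⟩
  obtain ⟨s, hs, hst, p, hp, hsp, hDp⟩ := hγ.exists_le_gromovProduct hx hnear ht hfar
  obtain ⟨s', hs', hst', q, hq, hsq, hDq⟩ := hγ.symm.exists_le_gromovProduct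
    (t := dist x y - t) hy
    (fun s hs => by
      rw [dist_comm y x] at hs
      exact hnear _ ⟨by linarith [hs.2], by linarith [hs.1]⟩)
    (by rw [dist_comm y x]; exact ⟨by linarith [ht.2], by linarith [ht.1]⟩)
    (by simpa using hfar)
  rw [sub_sub_cancel] at hDq
  have htu : t ≤ dist x y - s' := by linarith [hs'.2]
  have hu : dist x y - s' ≤ dist x y := by linarith [hs'.1]
  refine ⟨p, hp, q, hq, ?_, ?_⟩
  · linarith [dist_triangle4 p (γ s) (γ (dist x y - s')) q, dist_comm p (γ s),
      hγ.dist_eq_sub hs.1 (hs.2.trans htu) hu]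
  · have hchain := hδ.min_min_sub_le (γ s) (γ (dist x y - s')) (γ t) p q
    rw [hγ.gromovProduct_eq_zero hs.1 hs.2 htu hu] at hchain
    rw [gromovProduct_comm] at hDq
    have hmin : min D (gromovProduct dist p q (γ t)) ≤ min (gromovProduct dist (γ s) p (γ t))
        (min (gromovProduct dist p q (γ t))
          (gromovProduct dist q (γ (dist x y - s')) (γ t))) :=
      le_min ((min_le_left _ _).trans hDp)
        (le_min (min_le_right _ _) ((min_le_left _ _).trans hDq))
    linarith

end IsGeodesic

/-! ### Stability of quasi-geodesics -/

theorem eventually_affine_le_two_pow (a b : ℝ) : ∀ᶠ k : ℕ in atTop, a * k + b ≤ 2 ^ k := by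
  have hlin : (fun k : ℕ => a * k) =o[atTop] fun k : ℕ => (2 : ℝ) ^ k :=
    (isLittleO_coe_const_pow_of_one_lt one_lt_two).const_mul_left a
  have hconst : (fun _ : ℕ => b) =o[atTop] fun k : ℕ => (2 : ℝ) ^ k :=
    isLittleO_const_left.2 <| .inr <|
      tendsto_norm_atTop_atTop.comp (tendsto_pow_atTop_atTop_of_one_lt one_lt_two)
  filter_upwards [(hlin.add hconst).bound one_pos] with k hk
  rw [one_mul, Real.norm_eq_abs, Real.norm_of_nonneg (by positivity : (0 : ℝ) ≤ 2 ^ k)] at hk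
  exact (le_abs_self _).trans hk

theorem exists_bound_of_le_log {a δ : ℝ} (ha : 0 ≤ a) (hδ : 0 ≤ δ) (b c : ℝ) :
    ∃ C : ℝ, ∀ D : ℝ, (∀ k : ℕ, a * D + b ≤ 2 ^ k → D ≤ c + δ * k) → D ≤ C := by
  set M := 2 * (δ + 1) with hM
  have hMpos : 0 < M := by positivity
  obtain ⟨K, hK⟩ := eventually_atTop.1 (eventually_affine_le_two_pow (a * M) b)
  refine ⟨max (M * K) (2 * (c + δ)), fun D hD => ?_⟩
  by_contra! hlt
  obtain ⟨hKD, hcD⟩ := max_lt_iff.1 hlt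
  have hDpos : 0 < D := lt_of_le_of_lt (by positivity) hKD
  set k := ⌈D / M⌉₊
  have hDk : D ≤ M * k := (div_le_iff₀' hMpos).1 (Nat.le_ceil _)
  have hkD : (k : ℝ) < D / M + 1 := Nat.ceil_lt_add_one (by positivity)
  have hKk : K ≤ k := by
    exact_mod_cast (lt_of_mul_lt_mul_left (hKD.trans_le hDk) hMpos.le).le
  have hlog : D ≤ c + δ * k := hD k <| by
    linarith [hK k hKk, mul_le_mul_of_nonneg_left hDk ha]
  have hhalf : δ * (D / M) ≤ D / 2 := by
    rw [hM, mul_div_assoc', div_le_div_iff₀ (by positivity) two_pos]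
    nlinarith
  linarith [mul_le_mul_of_nonneg_left hkD.le hδ]

/-- `u 0, …, u n` is a discrete quasi-geodesic: its steps have length at most `A`, and the number
of steps between two of its points is at most affine in their distance. -/
structure IsDiscreteQuasiGeodesic (u : ℕ → Y) (n : ℕ) (A a b : ℝ) : Prop where
  dist_succ_le : ∀ l < n, dist (u l) (u (l + 1)) ≤ A
  sub_le : ∀ i ≤ n, ∀ j ≤ n, (j : ℝ) - i ≤ a * dist (u i) (u j) + b

theorem IsDiscreteQuasiGeodesic.sub_mul_le_gromovProduct {u : ℕ → Y} {n : ℕ} {A a b δ D : ℝ}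
    (hu : IsDiscreteQuasiGeodesic u n A a b) (hδ : GromovHyperbolicWith (dist : Y → Y → ℝ) δ)
    {p : Y} (hfar : ∀ l ≤ n, D ≤ dist (u l) p) {k i j : ℕ} (hi : i ≤ n) (hj : j ≤ n)
    (hk : a * dist (u i) (u j) + b ≤ 2 ^ k) :
    D - |A| - k * δ ≤ gromovProduct dist (u i) (u j) p := by
  wlog hij : i ≤ j generalizing i j
  · rw [gromovProduct_comm]
    exact this hj hi (by rwa [dist_comm]) (le_of_not_ge hij)
  refine hδ.sub_mul_le_gromovProduct_of_chain
    (fun l hl => by linarith [hfar l hl, abs_nonneg A]) (fun l hl => ?_) k hij hj ?_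
  · linarith [dist_sub_dist_le_gromovProduct (u l) (u (l + 1)) p, hfar l hl.le,
      hu.dist_succ_le l hl, le_abs_self A]
  · have : (j : ℝ) ≤ i + 2 ^ k := by linarith [hu.sub_le i hi j hj]
    exact_mod_cast this

theorem IsGeodesic.exists_isMaxOn_infDist {γ : ℝ → Y} {x y : Y} (hγ : IsGeodesic γ x y)
    (S : Set Y) : ∃ t ∈ Icc 0 (dist x y),
      IsMaxOn (fun s => Metric.infDist (γ s) S) (Icc 0 (dist x y)) t :=
  isCompact_Icc.exists_isMaxOn (nonempty_Icc.2 dist_nonneg)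
    ((Metric.continuous_infDist_pt S).comp_continuousOn hγ.continuousOn)

theorem exists_forall_dist_quasiGeodesic_le (hY : GromovHyperbolic (dist : Y → Y → ℝ))
    (A : ℝ) {a : ℝ} (ha : 0 ≤ a) (b : ℝ) :
    ∃ C : ℝ, ∀ (n : ℕ) (u : ℕ → Y) (γ : ℝ → Y), IsDiscreteQuasiGeodesic u n A a b →
      IsGeodesic γ (u 0) (u n) →
        ∀ t ∈ Icc 0 (dist (u 0) (u n)), ∃ i ≤ n, dist (γ t) (u i) ≤ C := by
  rcases isEmpty_or_nonempty Y with hempty | hnonempty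
  · exact ⟨0, fun _ u => (hempty.false (u 0)).elim⟩
  obtain ⟨δ, hδ⟩ := hY
  have hδ0 : 0 ≤ δ := GromovHyperbolicWith.nonneg hδ
  obtain ⟨C, hC⟩ := exists_bound_of_le_log (a := a * 6) (by positivity) hδ0 b (|A| + 2 * δ)
  refine ⟨C, fun n u γ hu hγ => ?_⟩
  let S : Set Y := u '' Iic n
  have hattained (s : ℝ) : ∃ q ∈ S, dist (γ s) q = Metric.infDist (γ s) S := by
    obtain ⟨q, hq, h⟩ := ((finite_Iic n).image u).isCompact.exists_infDist_eq_dist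
      ⟨u 0, 0, Nat.zero_le n, rfl⟩ (γ s)
    exact ⟨q, hq, h.symm⟩
  obtain ⟨t, ht, hmax⟩ := hγ.exists_isMaxOn_infDist S
  set D := Metric.infDist (γ t) S
  have hnear : ∀ s ∈ Icc 0 (dist (u 0) (u n)), ∃ q ∈ S, dist (γ s) q ≤ D := fun s hs =>
    (hattained s).imp fun q hq => ⟨hq.1, hq.2.trans_le (hmax hs)⟩
  suffices hDC : D ≤ C by
    intro s hs
    obtain ⟨_, ⟨i, hi, rfl⟩, h⟩ := hnear s hs
    exact ⟨i, hi, h.trans hDC⟩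
  have hfar : ∀ q ∈ S, D ≤ dist q (γ t) := fun q hq => by
    rw [dist_comm]
    exact Metric.infDist_le_dist_of_mem hq
  obtain ⟨_, ⟨i, hi, rfl⟩, _, ⟨j, hj, rfl⟩, hij, hmin⟩ :=
    hγ.exists_dist_le_min_gromovProduct_le (S := S) hδ ⟨0, Nat.zero_le n, rfl⟩
      ⟨n, self_mem_Iic, rfl⟩ hnear ht hfar
  refine hC D fun k hk => ?_
  have hlong := hu.sub_mul_le_gromovProduct hδ (fun l hl => hfar _ ⟨l, hl, rfl⟩) hi hj
    (k := k) (by linarith [mul_le_mul_of_nonneg_left hij ha])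
  rcases min_le_iff.1 hmin with h | h
  · linarith [abs_nonneg A, mul_nonneg hδ0 k.cast_nonneg]
  · linarith

end PseudoMetric

/-! ### Graphs quasi-isometrically embedded in hyperbolic spaces -/

section Graph

variable {V : Type*} {G : SimpleGraph V}

theorem cast_graphDist_triangle (hG : G.Connected) (u v w : V) :
    (G.dist u w : ℝ) ≤ G.dist u v + G.dist v w := by
  exact_mod_cast hG.dist_triangle

theorem graphDist_getVert_left {v w : V} {W : G.Walk v w} (hW : W.length = G.dist v w) {i : ℕ}
    (hi : i ≤ W.length) : G.dist v (W.getVert i) = i := by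
  rw [← SimpleGraph.length_eq_dist_of_subwalk hW (W.isSubwalk_take i),
    SimpleGraph.Walk.take_length, min_eq_left hi]

theorem graphDist_getVert_right {v w : V} {W : G.Walk v w} (hW : W.length = G.dist v w)
    (i : ℕ) : G.dist (W.getVert i) w = W.length - i := by
  rw [← SimpleGraph.length_eq_dist_of_subwalk hW (W.isSubwalk_drop i),
    SimpleGraph.Walk.drop_length]

/-- `f` is a quasi-isometric embedding of the vertex set of `G`, with its path metric: the upper
bound is only required on edges, whence it follows for all pairs by adding up along paths. -/
structure IsQuasiIsometricEmbedding {Y : Type*} [PseudoMetricSpace Y] (G : SimpleGraph V)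
    (f : V → Y) (A a b : ℝ) : Prop where
  dist_le_of_adj : ∀ v w, G.Adj v w → dist (f v) (f w) ≤ A
  graphDist_le : ∀ v w, (G.dist v w : ℝ) ≤ a * dist (f v) (f w) + b

namespace IsQuasiIsometricEmbedding

section PseudoMetric

variable {Y : Type*} [PseudoMetricSpace Y] {f : V → Y} {A a b : ℝ}

theorem isDiscreteQuasiGeodesic (hf : IsQuasiIsometricEmbedding G f A a b) (hG : G.Connected)
    {v w : V} {W : G.Walk v w} (hW : W.length = G.dist v w) :
    IsDiscreteQuasiGeodesic (fun i => f (W.getVert i)) W.length A a b where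
  dist_succ_le l hl := hf.dist_le_of_adj _ _ (W.adj_getVert_succ hl)
  sub_le i hi j hj := by
    have htri := cast_graphDist_triangle hG v (W.getVert i) (W.getVert j)
    rw [graphDist_getVert_left hW hi, graphDist_getVert_left hW hj] at htri
    linarith [hf.graphDist_le (W.getVert i) (W.getVert j)]

theorem exists_dist_le_between (hf : IsQuasiIsometricEmbedding G f A a b) (hG : G.Connected)
    (hY : GromovHyperbolic (dist : Y → Y → ℝ)) (ha : 0 ≤ a) :
    ∃ C : ℝ, ∀ (x y : V) (γ : ℝ → Y), IsGeodesic γ (f x) (f y) →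
      ∀ t ∈ Icc 0 (dist (f x) (f y)), ∃ v, dist (γ t) (f v) ≤ C ∧
        G.dist x v + G.dist v y = G.dist x y := by
  obtain ⟨C, hC⟩ := exists_forall_dist_quasiGeodesic_le hY A ha b
  refine ⟨C, fun x y γ hγ t ht => ?_⟩
  obtain ⟨W, hW⟩ := hG.exists_walk_length_eq_dist x y
  obtain ⟨i, hi, hit⟩ := hC W.length (fun i => f (W.getVert i)) γ
    (hf.isDiscreteQuasiGeodesic hG hW) (by simpa using hγ) t (by simpa using ht)
  refine ⟨W.getVert i, hit, ?_⟩
  rw [graphDist_getVert_left hW hi, graphDist_getVert_right hW]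
  omega

end PseudoMetric

variable {Y : Type*} [MetricSpace Y] {f : V → Y} {A a b : ℝ}

theorem exists_graph_gromovProduct_le (hf : IsQuasiIsometricEmbedding G f A a b)
    (hG : G.Connected) (hgeod : IsGeodesicSpace Y) (hY : GromovHyperbolic (dist : Y → Y → ℝ))
    (ha : 0 ≤ a) (c : ℝ) :
    ∃ C : ℝ, ∀ x y v : V, gromovProduct (fun v w => dist (f v) (f w)) x y v ≤ c →
      gromovProduct (fun v w => (G.dist v w : ℝ)) x y v ≤ C := by
  obtain ⟨C, hC⟩ := hf.exists_dist_le_between hG hY ha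
  obtain ⟨δ, hδ⟩ := hY
  refine ⟨a * (c + 2 * δ + C) + b, fun x y v hv => ?_⟩
  obtain ⟨γ, h0, h1, hdist⟩ := hgeod (f x) (f y)
  have hγ : IsGeodesic γ (f x) (f y) := ⟨h0, h1, hdist⟩
  obtain ⟨w, hw, hxwy⟩ := hC x y γ hγ _ (gromovProduct_mem_Icc (f x) (f y) (f v))
  have hwv : dist (f w) (f v) ≤ c + 2 * δ + C := by
    have hγv := hγ.dist_apply_gromovProduct_le hδ (f v)
    have hv' : gromovProduct dist (f x) (f y) (f v) ≤ c := hv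
    linarith [dist_triangle_left (f w) (f v) (γ (gromovProduct dist (f y) (f v) (f x)))]
  have hzero : gromovProduct (fun v w => (G.dist v w : ℝ)) x y w = 0 := by
    have hsum : (G.dist x w : ℝ) + G.dist w y = G.dist x y := by exact_mod_cast hxwy
    rw [gromovProduct, SimpleGraph.dist_comm (u := y), hsum, sub_self, zero_div]
  calc gromovProduct (fun v w => (G.dist v w : ℝ)) x y v
      ≤ 0 + G.dist w v := hzero ▸ gromovProduct_le_add (cast_graphDist_triangle hG) x y v w
    _ ≤ a * dist (f w) (f v) + b := by linarith [hf.graphDist_le w v]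
    _ ≤ a * (c + 2 * δ + C) + b := by gcongr

theorem exists_center (hf : IsQuasiIsometricEmbedding G f A a b) (hG : G.Connected)
    (hgeod : IsGeodesicSpace Y) (hY : GromovHyperbolic (dist : Y → Y → ℝ)) (ha : 0 ≤ a) :
    ∃ c : ℝ, ∀ x y z : V, ∃ v, gromovProduct dist (f x) (f y) (f v) ≤ c ∧
      gromovProduct dist (f x) (f z) (f v) ≤ c ∧ gromovProduct dist (f y) (f z) (f v) ≤ c := by
  have : Nonempty Y := hG.nonempty.map f
  obtain ⟨C, hC⟩ := hf.exists_dist_le_between hG hY ha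
  obtain ⟨δ, hδ⟩ := hY
  have hδ0 : 0 ≤ δ := GromovHyperbolicWith.nonneg hδ
  refine ⟨δ + C, fun x y z => ?_⟩
  obtain ⟨γ, h0, h1, hdist⟩ := hgeod (f x) (f y)
  have hγ : IsGeodesic γ (f x) (f y) := ⟨h0, h1, hdist⟩
  have ht := gromovProduct_mem_Icc (f x) (f y) (f z)
  obtain ⟨v, hv, -⟩ := hC x y γ hγ _ ht
  have hxy : gromovProduct dist (f x) (f y) (γ (gromovProduct dist (f y) (f z) (f x))) = 0 := by
    simpa [hγ.map_zero, hγ.map_dist] using hγ.gromovProduct_eq_zero le_rfl ht.1 ht.2 le_rfl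
  obtain ⟨hxz, hyz⟩ := hγ.gromovProduct_apply_gromovProduct_le hδ (f z)
  have hmove (p q : Y)
      (h : gromovProduct dist p q (γ (gromovProduct dist (f y) (f z) (f x))) ≤ δ) :
      gromovProduct dist p q (f v) ≤ δ + C :=
    (gromovProduct_le_add dist_triangle p q _ _).trans (add_le_add h hv)
  exact ⟨v, hmove _ _ (hxy.trans_le hδ0), hmove _ _ hxz, hmove _ _ hyz⟩

theorem gromovHyperbolic (hf : IsQuasiIsometricEmbedding G f A a b) (hG : G.Connected)
    (hgeod : IsGeodesicSpace Y) (hY : GromovHyperbolic (dist : Y → Y → ℝ)) (ha : 0 ≤ a) :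
    GromovHyperbolic fun v w : V => (G.dist v w : ℝ) :=
  gromovHyperbolic_of_gromovProduct_le_of_centers
    (fun _ _ => congrArg _ SimpleGraph.dist_comm) (cast_graphDist_triangle hG)
    (hY.imp fun _ hδ x y z w => hδ (f x) (f y) (f z) (f w))
    (hf.exists_graph_gromovProduct_le hG hgeod hY ha) (hf.exists_center hG hgeod hY ha)

end IsQuasiIsometricEmbedding

namespace MetricGraphPoint

theorem dist_src_tgt_le_one (p : MetricGraphPoint G) : G.dist p.src p.tgt ≤ 1 := by
  rcases p.edge with h | ⟨h, -⟩
  · exact (SimpleGraph.dist_eq_one_iff_adj.2 h).le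
  · simp [h]

theorem abs_dist_sub_graphDist_src_le (hG : G.Connected) (p q : MetricGraphPoint G) :
    |p.dist q - G.dist p.src q.src| ≤ 2 := by
  obtain ⟨hp0, hp1⟩ := p.pos_mem
  obtain ⟨hq0, hq1⟩ := q.pos_mem
  have hp : (G.dist p.src p.tgt : ℝ) ≤ 1 := by exact_mod_cast p.dist_src_tgt_le_one
  have hq : (G.dist q.src q.tgt : ℝ) ≤ 1 := by exact_mod_cast q.dist_src_tgt_le_one
  have htri := cast_graphDist_triangle hG
  have hcomm : (G.dist q.src q.tgt : ℝ) = G.dist q.tgt q.src :=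
    congrArg _ SimpleGraph.dist_comm
  unfold MetricGraphPoint.dist
  split_ifs with hsame hflip
  · rw [hsame.1, SimpleGraph.dist_self, Nat.cast_zero, sub_zero, abs_abs, abs_le]
    constructor <;> linarith
  · have hpos : |p.pos - (1 - q.pos)| ≤ 1 := abs_le.2 ⟨by linarith, by linarith⟩
    have hdist : (0 : ℝ) ≤ G.dist p.src q.src := Nat.cast_nonneg _
    rw [← hflip.2] at hdist ⊢
    exact abs_le.2 ⟨by linarith [abs_nonneg (p.pos - (1 - q.pos))], by linarith⟩
  · rw [abs_le]
    constructor
    · rw [neg_le_sub_iff_le_add, ← sub_le_iff_le_add]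
      have hsrc := htri p.src q.tgt q.src
      have hvia := htri p.src p.tgt q.src
      have htgt := htri p.tgt q.tgt q.src
      refine le_min (le_min ?_ ?_) (le_min ?_ ?_) <;> linarith
    · rw [sub_le_iff_le_add]
      refine (min_le_left _ _).trans ((min_le_left _ _).trans ?_)
      linarith

theorem gromovHyperbolic_dist (hG : G.Connected)
    (h : GromovHyperbolic fun v w : V => (G.dist v w : ℝ)) :
    GromovHyperbolic (MetricGraphPoint.dist : MetricGraphPoint G → _ → ℝ) :=
  h.of_abs_sub_le MetricGraphPoint.src (abs_dist_sub_graphDist_src_le hG)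

end MetricGraphPoint

end Graph

/-! ### Proximity graphs of cobounded maps -/

section Proximity

variable {V Y : Type*}

/-- The graph on `V` joining distinct points whose images under `f` are at distance at most `s`;
for the orbit map `σ_x` it is the graph that `proximityGraph` induces on the class of `x`. -/
def mapProximityGraph [PseudoMetricSpace Y] (f : V → Y) (s : ℝ) : SimpleGraph V :=
  SimpleGraph.fromRel fun v w => dist (f v) (f w) ≤ s

theorem mapProximityGraph_adj [PseudoMetricSpace Y] {f : V → Y} {s : ℝ} {v w : V} :
    (mapProximityGraph f s).Adj v w ↔ v ≠ w ∧ dist (f v) (f w) ≤ s := by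
  rw [mapProximityGraph, SimpleGraph.fromRel_adj, dist_comm (f w), or_self]

theorem exists_walk_mapProximityGraph_of_dist_le [PseudoMetricSpace Y] {f : V → Y} {s : ℝ}
    {v w : V} (h : dist (f v) (f w) ≤ s) :
    ∃ W : (mapProximityGraph f s).Walk v w, W.length ≤ 1 := by
  by_cases hvw : v = w
  · subst hvw
    exact ⟨.nil, by simp⟩
  · exact ⟨.cons (mapProximityGraph_adj.2 ⟨hvw, h⟩) .nil, by simp⟩

variable [MetricSpace Y] {f : V → Y} {r s : ℝ}

theorem IsGeodesicSpace.exists_dist_le_dist_le (hY : IsGeodesicSpace Y) {p q : Y} {a b : ℝ}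
    (ha : 0 ≤ a) (hb : 0 ≤ b) (hpq : dist p q ≤ a + b) :
    ∃ m, dist p m ≤ a ∧ dist m q ≤ b := by
  obtain ⟨γ, h0, h1, hdist⟩ := hY p q
  have hγ : IsGeodesic γ p q := ⟨h0, h1, hdist⟩
  have ht : min a (dist p q) ∈ Icc 0 (dist p q) := ⟨le_min ha dist_nonneg, min_le_right _ _⟩
  refine ⟨γ (min a (dist p q)), (hγ.dist_left ht).trans_le (min_le_left _ _), ?_⟩
  rw [hγ.dist_right ht]
  rcases min_choice a (dist p q) with h | h <;> rw [h] <;> linarith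

theorem exists_walk_mapProximityGraph (hY : IsGeodesicSpace Y)
    (hcob : ∀ p, ∃ v, dist p (f v) < r) (hs : 2 * r < s) (n : ℕ) {p : Y} {v w : V}
    (hv : dist p (f v) < r) (hw : dist p (f w) ≤ n * (s - 2 * r)) :
    ∃ W : (mapProximityGraph f s).Walk v w, W.length ≤ n + 1 := by
  induction n generalizing p v with
  | zero =>
    have hpw : dist p (f w) ≤ 0 := by simpa using hw
    simpa using exists_walk_mapProximityGraph_of_dist_le (f := f) (s := s) (v := v) (w := w) (by
      linarith [dist_triangle_left (f v) (f w) p, dist_nonneg (x := p) (y := f v)])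
  | succ n ih =>
    have hstep : 0 ≤ s - 2 * r := by linarith
    obtain ⟨m, hpm, hmw⟩ := hY.exists_dist_le_dist_le hstep
      (mul_nonneg n.cast_nonneg hstep) (hw.trans_eq (by push_cast; ring))
    obtain ⟨u, hu⟩ := hcob m
    obtain ⟨W, hW⟩ := ih hu hmw
    obtain ⟨E, hE⟩ := exists_walk_mapProximityGraph_of_dist_le (f := f) (s := s) (v := v)
      (w := u) (by linarith [dist_triangle4 (f v) p m (f u), dist_comm (f v) p])
    exact ⟨E.append W, by rw [SimpleGraph.Walk.length_append]; omega⟩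

theorem exists_walk_mapProximityGraph_length_le (hY : IsGeodesicSpace Y)
    (hcob : ∀ p, ∃ v, dist p (f v) < r) (hs : 2 * r < s) (v w : V) :
    ∃ W : (mapProximityGraph f s).Walk v w,
      (W.length : ℝ) ≤ (s - 2 * r)⁻¹ * dist (f v) (f w) + 2 := by
  have hstep : 0 < s - 2 * r := by linarith
  have hr : 0 < r := dist_nonneg.trans_lt (hcob (f v)).choose_spec
  have hle := Nat.le_ceil (dist (f v) (f w) / (s - 2 * r))
  have hlt := Nat.ceil_lt_add_one (div_nonneg (dist_nonneg (x := f v) (y := f w)) hstep.le)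
  obtain ⟨W, hW⟩ := exists_walk_mapProximityGraph (p := f v) (v := v) (w := w) hY hcob hs _
    (by rwa [dist_self]) ((div_le_iff₀ hstep).1 hle)
  refine ⟨W, ?_⟩
  rw [inv_mul_eq_div]
  have hW' : (W.length : ℝ) ≤ ⌈dist (f v) (f w) / (s - 2 * r)⌉₊ + 1 := by exact_mod_cast hW
  linarith

theorem connected_mapProximityGraph [Nonempty V] (hY : IsGeodesicSpace Y)
    (hcob : ∀ p, ∃ v, dist p (f v) < r) (hs : 2 * r < s) : (mapProximityGraph f s).Connected :=
  ⟨fun v w => (exists_walk_mapProximityGraph_length_le hY hcob hs v w).nonempty⟩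

theorem isQuasiIsometricEmbedding_mapProximityGraph (hY : IsGeodesicSpace Y)
    (hcob : ∀ p, ∃ v, dist p (f v) < r) (hs : 2 * r < s) :
    IsQuasiIsometricEmbedding (mapProximityGraph f s) f s (s - 2 * r)⁻¹ 2 where
  dist_le_of_adj _ _ h := (mapProximityGraph_adj.1 h).2
  graphDist_le v w := by
    obtain ⟨W, hW⟩ := exists_walk_mapProximityGraph_length_le hY hcob hs v w
    exact (Nat.cast_le.2 (SimpleGraph.dist_le W)).trans hW

end Proximity

/-! ### The proximity relation of a section -/

section Relations

variable {X : Type*}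

theorem isLeast_of_connected_graphAt {R : Setoid X} {𝒢 : Set (X × X)}
    (hsub : ∀ x y, (x, y) ∈ 𝒢 → R x y) (hconn : ∀ x, (graphAt R 𝒢 x).Connected) :
    IsLeast {S : Setoid X | ∀ x y : X, (x, y) ∈ 𝒢 → S x y} R := by
  refine ⟨hsub, fun S hS x y hxy => ?_⟩
  have hadj (v w : EqClass R x) (h : (graphAt R 𝒢 x).Adj v w) : S v.1 w.1 :=
    ((SimpleGraph.fromRel_adj _ _ _).1 h).2.elim (hS _ _) fun h => S.symm (hS _ _ h)
  have hreach (w : EqClass R x) (h : (graphAt R 𝒢 x).Reachable ⟨x, R.refl x⟩ w) : S x w.1 := by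
    rw [SimpleGraph.reachable_iff_reflTransGen] at h
    induction h with
    | refl => exact S.refl _
    | tail _ h ih => exact S.trans ih (hadj _ _ h)
  exact hreach ⟨y, hxy⟩ ((hconn x).preconnected _ _)

end Relations

section Action

variable {X H : Type*} [MeasurableSpace X] [MeasurableSpace H]

namespace MetricBundle

variable (B : MetricBundle X H)

/-- The pairs of points of a common fiber at distance at most `s`. -/
def closePairs (s : ℝ) : Set (H × H) :=
  {p | ∃ h : B.proj p.1 = B.proj p.2,
    dist (α := B.Fiber (B.proj p.2)) ⟨p.1, h⟩ ⟨p.2, rfl⟩ ≤ s}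

theorem mk_mem_closePairs {s : ℝ} {x : X} (p q : B.Fiber x) :
    (p.1, q.1) ∈ B.closePairs s ↔ dist p q ≤ s := by
  obtain ⟨p, hp⟩ := p
  obtain ⟨q, rfl⟩ := q
  exact ⟨fun h => h.2, fun h => ⟨hp, h⟩⟩

theorem measurableSet_closePairs [MeasurableEq X] (s : ℝ) : MeasurableSet (B.closePairs s) := by
  have hfiber : MeasurableSet {p : H × H | B.proj p.1 = B.proj p.2} :=
    measurableSet_eq_fun (B.measurable_proj.comp measurable_fst)
      (B.measurable_proj.comp measurable_snd)
  convert hfiber.subtype_image (B.measurable_dist (measurableSet_Iic (a := s))) using 1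
  ext ⟨p, q⟩
  constructor
  · rintro ⟨h, hle⟩
    exact ⟨⟨(p, q), h⟩, (B.mk_mem_closePairs ⟨p, rfl⟩ ⟨q, h.symm⟩).1 ⟨h, hle⟩, rfl⟩
  · rintro ⟨⟨_, h⟩, hle, rfl⟩
    exact (B.mk_mem_closePairs ⟨p, rfl⟩ ⟨q, h.symm⟩).2 hle

end MetricBundle

namespace IsometricAction

variable {R : Setoid X} {B : MetricBundle X H} (α : IsometricAction R B) (σ : BorelSection B)

/-- The pairs `(p, q)` with `α(π(p), π(q)) q = p`, the set that is Borel by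
`IsometricAction.borel`. -/
def actionPairs : Set (H × H) :=
  {pq | ∃ h : R (B.proj pq.1) (B.proj pq.2),
    α.map h ⟨pq.2, rfl⟩ = (⟨pq.1, rfl⟩ : B.Fiber (B.proj pq.1))}

theorem mk_mem_actionPairs {x y : X} (p : B.Fiber x) (q : B.Fiber y) :
    (p.1, q.1) ∈ α.actionPairs ↔ ∃ h : R x y, α.map h q = p := by
  obtain ⟨p, rfl⟩ := p
  obtain ⟨q, rfl⟩ := q
  rfl

theorem map_refl (x : X) (p : B.Fiber x) : α.map (R.refl x) p = p :=
  (α.map (R.refl x)).injective (α.cocycle _ _ p)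

theorem mem_proximityGraph_iff {s : ℝ} {x y z : X} (hx : R z x) (hy : R z y) :
    (x, y) ∈ α.proximityGraph σ s ↔
      dist (α.orbitMap σ z ⟨x, hx⟩) (α.orbitMap σ z ⟨y, hy⟩) ≤ s :=
  ⟨fun ⟨h, hle⟩ => (α.dSigma_eq σ h hx hy).symm.trans_le hle,
    fun hle => ⟨R.trans (R.symm hx) hy, (α.dSigma_eq σ _ hx hy).trans_le hle⟩⟩

theorem measurableSet_graph_orbitMap [MeasurableEq X] (s : ℝ) :
    MeasurableSet {q : (X × X) × H | ∃ h : R q.1.1 q.1.2,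
      α.dSigma σ h ≤ s ∧ (α.orbitMap σ q.1.1 ⟨q.1.2, h⟩).1 = q.2} := by
  have hproj : MeasurableSet {q : (X × X) × H | B.proj q.2 = q.1.1} :=
    measurableSet_eq_fun (B.measurable_proj.comp measurable_snd)
      (measurable_fst.comp measurable_fst)
  have haction : MeasurableSet {q : (X × X) × H | (q.2, σ.toFun q.1.2) ∈ α.actionPairs} :=
    (measurable_snd.prodMk (σ.measurable_toFun.comp (measurable_snd.comp measurable_fst)))
      α.borel
  have hclose : MeasurableSet {q : (X × X) × H | (σ.toFun q.1.1, q.2) ∈ B.closePairs s} :=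
    ((σ.measurable_toFun.comp (measurable_fst.comp measurable_fst)).prodMk measurable_snd)
      (B.measurableSet_closePairs s)
  have hdSigma {x y : X} (h : R x y) :
      α.dSigma σ h = dist (σ.val x) (α.orbitMap σ x ⟨y, h⟩) :=
    congrArg (dist · _) (α.map_refl x (σ.val x))
  convert hproj.inter (haction.inter hclose) using 1
  ext ⟨⟨x, y⟩, p⟩
  constructor
  · rintro ⟨(h : R x y), hle, (hp : (α.orbitMap σ x ⟨y, h⟩).1 = p)⟩
    subst hp
    exact ⟨(α.orbitMap σ x ⟨y, h⟩).2, (α.mk_mem_actionPairs _ (σ.val y)).2 ⟨h, rfl⟩,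
      (B.mk_mem_closePairs (σ.val x) _).2 (hdSigma h ▸ hle)⟩
  · rintro ⟨hp, hpair, hle⟩
    obtain ⟨h, hmap⟩ := (α.mk_mem_actionPairs (⟨p, hp⟩ : B.Fiber x) (σ.val y)).1 hpair
    have hdist := (B.mk_mem_closePairs (σ.val x) (⟨p, hp⟩ : B.Fiber x)).1 hle
    rw [← hmap] at hdist
    exact ⟨h, (hdSigma h).trans_le hdist, congrArg Subtype.val hmap⟩

theorem measurableSet_proximityGraph [StandardBorelSpace X] [StandardBorelSpace H] (s : ℝ) :
    MeasurableSet (α.proximityGraph σ s) := by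
  have hinj : InjOn Prod.fst {q : (X × X) × H | ∃ h : R q.1.1 q.1.2,
      α.dSigma σ h ≤ s ∧ (α.orbitMap σ q.1.1 ⟨q.1.2, h⟩).1 = q.2} := by
    rintro ⟨xy, p⟩ ⟨_, -, hp⟩ ⟨_, p'⟩ ⟨_, -, hp'⟩ rfl
    exact Prod.ext rfl (hp.symm.trans hp')
  convert (α.measurableSet_graph_orbitMap σ s).image_of_measurable_injOn measurable_fst hinj
  ext xy
  exact ⟨fun ⟨h, hle⟩ => ⟨(xy, (α.orbitMap σ xy.1 ⟨xy.2, h⟩).1), ⟨h, hle, rfl⟩, rfl⟩,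
    by rintro ⟨q, ⟨h, hle, -⟩, rfl⟩; exact ⟨h, hle⟩⟩

theorem graphAt_proximityGraph (s : ℝ) (x : X) :
    graphAt R (α.proximityGraph σ s) x = mapProximityGraph (α.orbitMap σ x) s :=
  congrArg SimpleGraph.fromRel <| funext₂ fun v w =>
    propext (α.mem_proximityGraph_iff σ v.2 w.2)

variable {α σ} {r s : ℝ}

theorem Cobounded.connected_graphAt (hcob : α.Cobounded σ r)
    (hgeod : ∀ x, IsGeodesicSpace (B.Fiber x)) (hs : 2 * r < s) (x : X) :
    (graphAt R (α.proximityGraph σ s) x).Connected := by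
  have : Nonempty (EqClass R x) := ⟨⟨x, R.refl x⟩⟩
  rw [graphAt_proximityGraph]
  exact connected_mapProximityGraph (hgeod x) (hcob x) hs

theorem Cobounded.isGraphing_proximityGraph [StandardBorelSpace X] [StandardBorelSpace H]
    (hcob : α.Cobounded σ r) (hgeod : ∀ x, IsGeodesicSpace (B.Fiber x)) (hs : 2 * r < s) :
    IsGraphing R (α.proximityGraph σ s) where
  measurableSet := α.measurableSet_proximityGraph σ s
  symm x y := by
    rintro ⟨h, hle⟩
    rw [α.mem_proximityGraph_iff σ h (R.refl x), dist_comm]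
    exact hle
  generates := isLeast_of_connected_graphAt (fun _ _ h => h.1) (hcob.connected_graphAt hgeod hs)

theorem Cobounded.gromovHyperbolic_graphAt (hcob : α.Cobounded σ r) (hB : B.IsHyperbolic)
    (hs : 2 * r < s) (x : X) :
    GromovHyperbolic (MetricGraphPoint.dist :
      MetricGraphPoint (graphAt R (α.proximityGraph σ s) x) → _ → ℝ) := by
  have hconn := hcob.connected_graphAt (fun x => (hB x).1) hs x
  rw [graphAt_proximityGraph] at hconn ⊢
  have hqi := isQuasiIsometricEmbedding_mapProximityGraph (hB x).1 (hcob x) hs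
  exact MetricGraphPoint.gromovHyperbolic_dist hconn
    (hqi.gromovHyperbolic hconn (hB x).1 (hB x).2 (inv_nonneg.2 (by linarith)))

theorem MetricallyProper.isLocallyFinite_proximityGraph (hproper : α.MetricallyProper σ)
    (hfin : α.FiniteToOne σ) (s : ℝ) : IsLocallyFinite (α.proximityGraph σ s) := by
  intro x
  have hball := (hproper x (α.orbitMap σ x ⟨x, R.refl x⟩) (s + 1)).preimage'
    (f := α.orbitMap σ x) fun p _ => hfin x p
  refine (hball.image Subtype.val).subset ?_
  rintro y ⟨h, hle⟩
  refine ⟨⟨y, h⟩, ⟨mem_range_self _, ?_⟩, rfl⟩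
  rw [Metric.mem_ball, dist_comm]
  exact lt_of_le_of_lt hle (lt_add_one s)

end IsometricAction

end Action

end HypBundle

theorem mainTheorem9_general {X H : Type*} [MeasurableSpace X] [StandardBorelSpace X]
    [MeasurableSpace H] [StandardBorelSpace H] {R : Setoid X} {B : HypBundle.MetricBundle X H}
    (hB : B.IsHyperbolic) {α : HypBundle.IsometricAction R B} {σ : HypBundle.BorelSection B}
    {r s : ℝ} (hcob : α.Cobounded σ r) (hs : 2 * r < s) :
    HypBundle.IsHyperbolicGraphing R (α.proximityGraph σ s) ∧
      (α.MetricallyProper σ → α.FiniteToOne σ →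
        HypBundle.IsLocallyFinite (α.proximityGraph σ s)) :=
  ⟨⟨hcob.isGraphing_proximityGraph (fun x => (hB x).1) hs, hcob.gromovHyperbolic_graphAt hB hs⟩,
    fun hproper hfin => hproper.isLocallyFinite_proximityGraph hfin s⟩

theorem mainTheorem9 {X H : Type*} [MeasurableSpace X] [StandardBorelSpace X]
    [MeasurableSpace H] [StandardBorelSpace H]
    (R : Setoid X) (hR : HypBundle.IsDiscreteBorel R)
    (B : HypBundle.MetricBundle X H) (hB : B.IsHyperbolic)
    (α : HypBundle.IsometricAction R B) (σ : HypBundle.BorelSection B)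
    (hproper : α.MetricallyProper σ)
    (r : ℝ) (hr : 0 < r) (hcob : α.Cobounded σ r) :
    HypBundle.IsHyperbolicGraphing R (α.proximityGraph σ (3 * r)) ∧
      (α.FiniteToOne σ → HypBundle.IsLocallyFinite (α.proximityGraph σ (3 * r))) :=
  (mainTheorem9_general hB hcob (by linarith)).imp_right fun h => h hproper
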